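/- Let $N\ge 3$, let $\alpha,\beta>0$ satisfy $\alpha\beta>1$, and let $p,q:\mathbf R^N\to[0,\infty)$ be continuous spherically symmetric functions, $p(x)=p(|x|)$ and $q(x)=q(|x|)$. Suppose that there are real constants $\lambda,\nu,\mu,\xi$, $L_3>0$, $L_4>0$ and $r_1>1$ such that $$p(r)\le \frac{L_3}{r^{\lambda}\ln^{\nu} r},\qquad q(r)\le \frac{L_4}{r^{\mu}\ln^{\xi} r}\qquad\text{for all } r\ge r_1.$$ Suppose that at least one of the following conditions holds: (i) $2-\mu+\beta(2-\lambda)<0$ and $2-\lambda+\alpha(2-\mu)<0$; (ii) $2-\mu+\beta(2-\lambda)=0$, $\lambda<2$ and $1-\xi-\beta\nu<0$; (iii) $2-\lambda+\alpha(2-\mu)=0$, $\mu<2$ and $1-\nu-\alpha\xi<0$; (iv) $\lambda=2$, $\mu=2$, $1-\xi+\beta(1-\nu)<0$ and $1-\nu+\alpha(1-\xi)<0$. Then the system $$\Delta u=p(x)\,v^{\alpha},\qquad \Delta v=q(x)\,u^{\beta},\qquad x\in\mathbf R^N,$$ has a positive entire solution, i.e. there are $u,v\in C^2(\mathbf R^N)$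 with $u>0$ and $v>0$ everywhere which satisfy both equations at every point of $\mathbf R^N$. -/

import Mathlib

/-- A function on `ℝ^N` is spherically symmetric if its value at `x` depends only on `‖x‖`. -/
def IsRadial {N : ℕ} (f : EuclideanSpace ℝ (Fin N) → ℝ) : Prop :=
  ∀ x y : EuclideanSpace ℝ (Fin N), ‖x‖ = ‖y‖ → f x = f y

/-- `(u, v)` is a positive entire (classical) solution of the system
`Δ u = p(x) v ^ α`, `Δ v = q(x) u ^ β` on the whole of `ℝ^N`. -/
structure IsPositiveEntireSolution {N : ℕ} (α β : ℝ) (p q : EuclideanSpace ℝ (Fin N) → ℝ)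
    (u v : EuclideanSpace ℝ (Fin N) → ℝ) : Prop where
  contDiff_fst : ContDiff ℝ 2 u
  contDiff_snd : ContDiff ℝ 2 v
  pos_fst : ∀ x, 0 < u x
  pos_snd : ∀ x, 0 < v x
  laplacian_fst : ∀ x, Laplacian.laplacian u x = p x * v x ^ α
  laplacian_snd : ∀ x, Laplacian.laplacian v x = q x * u x ^ β

/-! Both unknowns are sought radial. With w(r) = ∫₀¹ σ^(N-1) F(σr) dσ, the profile a + ∫₀^r t w(t)
dt solves ΔΦ = F. Its gradient is w(‖x‖) x and its Hessian extends continuously through the origin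
because N w(0) = F(0), so the system reduces to a pair of integral equations for continuous
profiles.

These are solved by monotone iteration below a supersolution (U, V), starting from the constants
U(0), V(0). Since N ≥ 3, the first-order inequalities r P V^α ≤ U' and r Q U^β ≤ V' suffice
(`radialSol_le`). Because αβ > 1, they need only hold up to a constant factor: scaling U and V by
suitable powers of a small ε absorbs it (`exists_radial_solution_of_growth`).

The supersolution is U = x^k (log x)^m, V = x^l (log x)^n with x = M + r. Under (i) pure powers
work; under (iv) pure powers of the logarithm; under (ii) V is a power of log x and U has k = 2 - λ;
(iii) is (ii) with the two equations exchanged. -/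

open Set Filter Topology

/-! ### Integral formula for the radial Poisson equation -/

/-- The weighted mean `∫₀¹ σ^(N-1) F(σ r) dσ`; for the radial solution `Φ` of `Δ Φ = F` on `ℝ^N`
it equals `Φ'(r) / r`. -/
noncomputable def radialMean (N : ℕ) (F : ℝ → ℝ) (r : ℝ) : ℝ :=
  ∫ σ in (0 : ℝ)..1, σ ^ (N - 1) * F (σ * r)

/-- The radial profile of the solution of `Δ u = F(‖x‖)` on `ℝ^N` with `u 0 = a`. -/
noncomputable def radialSol (N : ℕ) (a : ℝ) (F : ℝ → ℝ) (r : ℝ) : ℝ :=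
  a + ∫ t in (0 : ℝ)..r, t * radialMean N F t

theorem continuous_radialMean (N : ℕ) {F : ℝ → ℝ} (hF : Continuous F) :
    Continuous (radialMean N F) := by
  unfold radialMean
  apply intervalIntegral.continuous_parametric_intervalIntegral_of_continuous
  · unfold Function.uncurry
    fun_prop
  · fun_prop

theorem radialMean_zero {N : ℕ} (hN : N ≠ 0) (F : ℝ → ℝ) : N * radialMean N F 0 = F 0 := by
  have h : ((N : ℝ)) ≠ 0 := by exact_mod_cast hN
  have h1 : ((N - 1 : ℕ) : ℝ) + 1 = N := by
    rw [Nat.cast_sub (by omega)]; simp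
  simp only [radialMean, mul_zero, intervalIntegral.integral_mul_const, integral_pow, h1]
  rw [Nat.sub_add_cancel (by omega)]
  simp [hN]

theorem pow_mul_radialMean {N : ℕ} (hN : N ≠ 0) (F : ℝ → ℝ) (r : ℝ) :
    r ^ N * radialMean N F r = ∫ s in (0 : ℝ)..r, s ^ (N - 1) * F s := by
  have h := intervalIntegral.mul_integral_comp_mul_right (a := 0) (b := 1)
    (f := fun s => s ^ (N - 1) * F s) (c := r)
  simp only [zero_mul, one_mul] at h
  rw [← h, radialMean]
  have e : r ^ N = r * r ^ (N - 1) := by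
    rw [← pow_succ', Nat.sub_add_cancel (by omega)]
  rw [e, mul_assoc, ← intervalIntegral.integral_const_mul]
  congr 1
  apply intervalIntegral.integral_congr
  intro σ _
  simp only [mul_pow]
  ring

theorem hasDerivAt_radialMean {N : ℕ} (hN : N ≠ 0) {F : ℝ → ℝ} (hF : Continuous F) {r : ℝ}
    (hr : r ≠ 0) : HasDerivAt (radialMean N F) ((F r - N * radialMean N F r) / r) r := by
  have hJ : HasDerivAt (fun r => ∫ s in (0 : ℝ)..r, s ^ (N - 1) * F s) (r ^ (N - 1) * F r) r := by
    have hc : Continuous fun s : ℝ => s ^ (N - 1) * F s := by fun_prop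
    exact intervalIntegral.integral_hasDerivAt_right (hc.intervalIntegrable _ _)
      (hc.stronglyMeasurableAtFilter _ _) hc.continuousAt
  have hd := hJ.div (hasDerivAt_pow N r) (pow_ne_zero N hr)
  have heq : radialMean N F =ᶠ[𝓝 r]
      (fun r => ∫ s in (0 : ℝ)..r, s ^ (N - 1) * F s) / (fun r => r ^ N) := by
    filter_upwards [isOpen_ne.mem_nhds hr] with s hs
    have hs' : s ^ N ≠ 0 := pow_ne_zero N hs
    simp only [Pi.div_apply]
    rw [← pow_mul_radialMean hN, mul_div_cancel_left₀ _ hs']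
  refine (hd.congr_of_eventuallyEq heq).congr_deriv ?_
  rw [← pow_mul_radialMean hN]
  have e : r ^ N = r * r ^ (N - 1) := by
    rw [← pow_succ', Nat.sub_add_cancel (by omega)]
  have h1 := pow_ne_zero (N - 1) hr
  rw [e]
  field_simp

theorem hasDerivAt_radialSol (N : ℕ) (a : ℝ) {F : ℝ → ℝ} (hF : Continuous F) (r : ℝ) :
    HasDerivAt (radialSol N a F) (r * radialMean N F r) r := by
  have hc : Continuous fun t => t * radialMean N F t :=
    continuous_id.mul (continuous_radialMean N hF)
  exact (intervalIntegral.integral_hasDerivAt_right (hc.intervalIntegrable _ _)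
      (hc.stronglyMeasurableAtFilter _ _) hc.continuousAt).const_add a

theorem continuous_radialSol (N : ℕ) (a : ℝ) {F : ℝ → ℝ} (hF : Continuous F) :
    Continuous (radialSol N a F) :=
  continuous_iff_continuousAt.2 fun r => (hasDerivAt_radialSol N a hF r).continuousAt

/-- Substituting ρ = t² makes the profile a C¹ function of ‖x‖², which is smooth at the origin,
unlike ‖x‖. -/
theorem radialSol_eq_comp_sq (N : ℕ) (a : ℝ) {F : ℝ → ℝ} (hF : Continuous F) {r : ℝ}
    (hr : 0 ≤ r) :
    radialSol N a F r = a + ∫ ρ in (0 : ℝ)..r ^ 2, radialMean N F (√ρ) / 2 := by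
  have hc := continuous_radialMean N hF
  have h := intervalIntegral.integral_comp_mul_deriv (a := 0) (b := r) (f := fun t : ℝ => t ^ 2)
    (f' := fun t => 2 * t) (g := fun ρ => radialMean N F (√ρ) / 2)
    (fun t _ => by simpa using hasDerivAt_pow 2 t) (by fun_prop)
    ((hc.comp Real.continuous_sqrt).div_const 2)
  simp only [ne_eq, OfNat.ofNat_ne_zero, not_false_eq_true, zero_pow] at h
  rw [radialSol, ← h]
  congr 1
  apply intervalIntegral.integral_congr
  intro t ht
  rw [uIcc_of_le hr] at ht
  simp only [Function.comp, Real.sqrt_sq ht.1]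
  ring

/-! ### Regularity and Laplacian of x ↦ Φ(‖x‖) -/

section Laplacian

variable {E : Type*} [NormedAddCommGroup E] [InnerProductSpace ℝ E]

/-- The real inner product as a continuous bilinear map. -/
noncomputable def realInnerCLM : E →L[ℝ] E →L[ℝ] ℝ := innerSL ℝ

@[simp]
theorem realInnerCLM_apply (x y : E) : realInnerCLM x y = inner ℝ x y := rfl

theorem norm_realInnerCLM_apply (x : E) : ‖realInnerCLM x‖ = ‖x‖ := innerSL_apply_norm ℝ x

theorem hasFDerivAt_radialSol_norm (N : ℕ) (a : ℝ) {F : ℝ → ℝ} (hF : Continuous F) (x : E) :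
    HasFDerivAt (fun x : E => radialSol N a F ‖x‖) (radialMean N F ‖x‖ • realInnerCLM x) x := by
  have hc : Continuous fun ρ => radialMean N F (√ρ) / 2 :=
    ((continuous_radialMean N hF).comp Real.continuous_sqrt).div_const 2
  have h1 : HasDerivAt (fun s => a + ∫ ρ in (0 : ℝ)..s, radialMean N F (√ρ) / 2)
      (radialMean N F (√(‖x‖ ^ 2)) / 2) (‖x‖ ^ 2) :=
    (intervalIntegral.integral_hasDerivAt_right (hc.intervalIntegrable _ _)
      (hc.stronglyMeasurableAtFilter _ _) hc.continuousAt).const_add a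
  have h2 := h1.comp_hasFDerivAt x (hasStrictFDerivAt_norm_sq x).hasFDerivAt
  rw [Real.sqrt_sq (norm_nonneg x)] at h2
  have e : (fun x : E => radialSol N a F ‖x‖) =
      (fun s => a + ∫ ρ in (0 : ℝ)..s, radialMean N F (√ρ) / 2) ∘ fun x : E => ‖x‖ ^ 2 := by
    ext y
    exact radialSol_eq_comp_sq N a hF (norm_nonneg y)
  rw [e]
  refine h2.congr_fderiv ?_
  ext y
  simp
  ring

/-- The Hessian of `x ↦ radialSol N a F ‖x‖`. -/
noncomputable def radialHess (N : ℕ) (F : ℝ → ℝ) (x : E) : E →L[ℝ] E →L[ℝ] ℝ :=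
  radialMean N F ‖x‖ • realInnerCLM +
    ((F ‖x‖ - N * radialMean N F ‖x‖) / ‖x‖ ^ 2) • (realInnerCLM x).smulRight (realInnerCLM x)

theorem hasFDerivAt_radialGrad {N : ℕ} (hN : N ≠ 0) {F : ℝ → ℝ} (hF : Continuous F) (x : E) :
    HasFDerivAt (fun x : E => radialMean N F ‖x‖ • realInnerCLM x) (radialHess N F x) x := by
  have hw := continuous_radialMean N hF
  by_cases hx : x = 0
  · subst hx
    -- The remainder at the origin is (w(‖h‖) - w(0)) h, which is o(h) by continuity of w alone.
    rw [hasFDerivAt_iff_isLittleO_nhds_zero]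
    have h1 : (fun h : E => radialMean N F ‖h‖ - radialMean N F 0) =o[𝓝 0] fun _ => (1 : ℝ) := by
      rw [Asymptotics.isLittleO_one_iff]
      have : Continuous fun h : E => radialMean N F ‖h‖ - radialMean N F 0 := by fun_prop
      simpa using this.tendsto 0
    have h2 : (fun h : E => realInnerCLM h) =O[𝓝 0] fun h : E => h := (realInnerCLM : E →L[ℝ] E →L[ℝ] ℝ).isBigO_id _
    have h3 := h1.smul_isBigO h2
    simp only [one_smul] at h3
    refine h3.congr_left fun h => ?_
    ext y
    simp [radialHess]
    ring
  · have hn : ‖x‖ ≠ 0 := norm_ne_zero_iff.2 hx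
    have hnorm : HasFDerivAt (fun x : E => ‖x‖) (‖x‖⁻¹ • realInnerCLM x) x := by
      have h := ((Real.hasDerivAt_sqrt (pow_ne_zero 2 hn)).comp_hasFDerivAt x
        (hasStrictFDerivAt_norm_sq x).hasFDerivAt)
      have e : (fun x : E => ‖x‖) = Real.sqrt ∘ fun x : E => ‖x‖ ^ 2 := by
        ext y
        simp [Real.sqrt_sq (norm_nonneg y)]
      rw [e]
      refine h.congr_fderiv ?_
      ext y
      simp [Real.sqrt_sq (norm_nonneg x)]
      ring
    have h1 := (hasDerivAt_radialMean hN hF hn).comp_hasFDerivAt x hnorm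
    have h2 := h1.smul ((realInnerCLM : E →L[ℝ] E →L[ℝ] ℝ).hasFDerivAt (x := x))
    refine h2.congr_fderiv ?_
    ext y z
    simp [radialHess]
    field_simp

theorem continuousAt_smul_of_tendsto_norm {X Z : Type*} [TopologicalSpace X]
    [NormedAddCommGroup Z] [NormedSpace ℝ Z] {c : X → ℝ} {B : X → Z} {x : X} (hx : B x = 0)
    (h : Tendsto (fun y => |c y| * ‖B y‖) (𝓝 x) (𝓝 0)) : ContinuousAt (fun y => c y • B y) x := by
  rw [ContinuousAt, hx, smul_zero]
  exact squeeze_zero_norm (fun y => by rw [norm_smul, Real.norm_eq_abs]) h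

theorem continuous_radialHess {N : ℕ} (hN : N ≠ 0) {F : ℝ → ℝ} (hF : Continuous F) :
    Continuous (radialHess N F : E → E →L[ℝ] E →L[ℝ] ℝ) := by
  have hw := continuous_radialMean N hF
  have hA : Continuous fun x : E => radialMean N F ‖x‖ • (realInnerCLM : E →L[ℝ] E →L[ℝ] ℝ) := by
    fun_prop
  have : ContinuousAdd (E →L[ℝ] E →L[ℝ] ℝ) :=
    (inferInstance : IsTopologicalAddGroup (E →L[ℝ] E →L[ℝ] ℝ)).toContinuousAdd
  suffices hB : Continuous fun x : E => ((F ‖x‖ - N * radialMean N F ‖x‖) / ‖x‖ ^ 2) •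
      (realInnerCLM x).smulRight (realInnerCLM x) from Continuous.add hA hB
  refine continuous_iff_continuousAt.2 fun x => ?_
  have hsm : Continuous fun x : E => (realInnerCLM x).smulRight (realInnerCLM x) :=
    ((ContinuousLinearMap.smulRightL ℝ E (E →L[ℝ] ℝ)).continuous₂.comp
      (realInnerCLM.continuous.prodMk realInnerCLM.continuous) :)
  have hnum : Continuous fun x : E => F ‖x‖ - N * radialMean N F ‖x‖ := by fun_prop
  by_cases hx : x = 0
  · subst hx
    refine continuousAt_smul_of_tendsto_norm (Z := E →L[ℝ] E →L[ℝ] ℝ)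
      (B := fun x => (realInnerCLM x).smulRight (realInnerCLM x)) (by ext y z; simp) ?_
    -- The rank-one factor has norm ‖x‖² and cancels the denominator; what remains tends to F(0) - N
    -- w(0) = 0.
    have hl : Tendsto (fun x : E => |F ‖x‖ - N * radialMean N F ‖x‖|) (𝓝 0) (𝓝 0) := by
      have := (hnum.tendsto 0).abs
      simpa [radialMean_zero hN] using this
    refine squeeze_zero (fun y => by positivity) (fun y => ?_) hl
    rw [ContinuousLinearMap.norm_smulRight_apply, norm_realInnerCLM_apply, ← sq, abs_div,
      abs_of_nonneg (sq_nonneg ‖y‖)]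
    by_cases hy : ‖y‖ = 0
    · simp [hy]
    · rw [div_mul_cancel₀ _ (pow_ne_zero 2 hy)]
  · refine ContinuousAt.smul (hnum.continuousAt.div (by fun_prop) ?_) hsm.continuousAt
    exact pow_ne_zero 2 (norm_ne_zero_iff.2 hx)

theorem contDiff_radialSol_norm {N : ℕ} (hN : N ≠ 0) (a : ℝ) {F : ℝ → ℝ} (hF : Continuous F) :
    ContDiff ℝ 2 fun x : E => radialSol N a F ‖x‖ := by
  have h := contDiff_succ_iff_hasFDerivAt (n := 1) (𝕜 := ℝ) (f := fun x : E => radialSol N a F ‖x‖)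
  norm_num at h
  rw [h]
  refine ⟨_, ?_, hasFDerivAt_radialSol_norm N a hF⟩
  rw [contDiff_one_iff_hasFDerivAt]
  exact ⟨_, continuous_radialHess hN hF, hasFDerivAt_radialGrad hN hF⟩

theorem laplacian_radialSol_norm [FiniteDimensional ℝ E] (hN : Module.finrank ℝ E ≠ 0) (a : ℝ)
    {F : ℝ → ℝ} (hF : Continuous F) (x : E) :
    Laplacian.laplacian (fun x : E => radialSol (Module.finrank ℝ E) a F ‖x‖) x = F ‖x‖ := by
  rw [InnerProductSpace.laplacian_eq_iteratedFDeriv_stdOrthonormalBasis]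
  have h1 : fderiv ℝ (fun x : E => radialSol (Module.finrank ℝ E) a F ‖x‖) =
      fun x => radialMean (Module.finrank ℝ E) F ‖x‖ • realInnerCLM x :=
    funext fun y => (hasFDerivAt_radialSol_norm _ a hF y).fderiv
  simp only [iteratedFDeriv_two_apply, h1, (hasFDerivAt_radialGrad hN hF x).fderiv]
  -- In the trace, the squared coordinates of x sum to ‖x‖², giving N w + (F - N w) = F.
  have h2 := (stdOrthonormalBasis ℝ E).sum_sq_norm_inner_left x
  simp only [Real.norm_eq_abs, sq_abs] at h2
  simp [radialHess, Finset.sum_add_distrib, ← Finset.mul_sum, ← sq, h2]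
  by_cases hx : x = 0
  · subst hx
    simpa using radialMean_zero hN F
  · have hn : ‖x‖ ≠ 0 := norm_ne_zero_iff.2 hx
    field_simp
    ring

end Laplacian

/-! ### Order, bounds and comparison for radial solutions -/

theorem radialMean_mono (N : ℕ) {F G : ℝ → ℝ} (hF : Continuous F) (hG : Continuous G)
    (h : ∀ r, 0 ≤ r → F r ≤ G r) {r : ℝ} (hr : 0 ≤ r) : radialMean N F r ≤ radialMean N G r := by
  have h1 : Continuous fun σ : ℝ => σ ^ (N - 1) * F (σ * r) := by fun_prop
  have h2 : Continuous fun σ : ℝ => σ ^ (N - 1) * G (σ * r) := by fun_prop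
  refine intervalIntegral.integral_mono_on zero_le_one (h1.intervalIntegrable _ _)
    (h2.intervalIntegrable _ _) fun σ hσ => ?_
  exact mul_le_mul_of_nonneg_left (h _ (mul_nonneg hσ.1 hr)) (pow_nonneg hσ.1 _)

theorem radialMean_nonneg (N : ℕ) {F : ℝ → ℝ} (h : ∀ r, 0 ≤ r → 0 ≤ F r) {r : ℝ} (hr : 0 ≤ r) :
    0 ≤ radialMean N F r :=
  intervalIntegral.integral_nonneg zero_le_one fun _ hσ =>
    mul_nonneg (pow_nonneg hσ.1 _) (h _ (mul_nonneg hσ.1 hr))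

theorem norm_mean_integrand_le (N : ℕ) {F : ℝ → ℝ} {R C : ℝ}
    (h : ∀ r, 0 ≤ r → r ≤ R → |F r| ≤ C) {r : ℝ} (hr : 0 ≤ r) (hrR : r ≤ R) {σ : ℝ}
    (hσ : σ ∈ uIoc (0 : ℝ) 1) : ‖σ ^ (N - 1) * F (σ * r)‖ ≤ C := by
  rw [uIoc_of_le zero_le_one] at hσ
  have h1 := h (σ * r) (mul_nonneg hσ.1.le hr)
    ((mul_le_of_le_one_left hr hσ.2).trans hrR)
  rw [norm_mul, Real.norm_eq_abs, Real.norm_eq_abs, abs_of_nonneg (pow_nonneg hσ.1.le _)]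
  exact (mul_le_of_le_one_left (abs_nonneg _) (pow_le_one₀ hσ.1.le hσ.2)).trans h1

theorem abs_radialMean_le (N : ℕ) {F : ℝ → ℝ} {R C : ℝ}
    (h : ∀ r, 0 ≤ r → r ≤ R → |F r| ≤ C) {r : ℝ} (hr : 0 ≤ r) (hrR : r ≤ R) :
    |radialMean N F r| ≤ C := by
  have := intervalIntegral.norm_integral_le_of_norm_le_const
    (fun σ hσ => norm_mean_integrand_le N h hr hrR hσ)
  simpa [radialMean] using this

theorem abs_mul_radialMean_le (N : ℕ) {F : ℝ → ℝ} {R C : ℝ}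
    (h : ∀ r, 0 ≤ r → r ≤ R → |F r| ≤ C) {r : ℝ} (hr : 0 ≤ r) (hrR : r ≤ R) :
    |r * radialMean N F r| ≤ R * C := by
  rw [abs_mul, abs_of_nonneg hr]
  exact mul_le_mul hrR (abs_radialMean_le N h hr hrR) (abs_nonneg _) (hr.trans hrR)

theorem radialSol_zero (N : ℕ) (a : ℝ) (F : ℝ → ℝ) : radialSol N a F 0 = a := by
  simp [radialSol]

theorem radialSol_mono (N : ℕ) (a : ℝ) {F G : ℝ → ℝ} (hF : Continuous F) (hG : Continuous G)
    (h : ∀ r, 0 ≤ r → F r ≤ G r) {r : ℝ} (hr : 0 ≤ r) : radialSol N a F r ≤ radialSol N a G r := by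
  have h1 : Continuous fun t : ℝ => t * radialMean N F t :=
    continuous_id.mul (continuous_radialMean N hF)
  have h2 : Continuous fun t : ℝ => t * radialMean N G t :=
    continuous_id.mul (continuous_radialMean N hG)
  refine add_le_add_right (intervalIntegral.integral_mono_on hr (h1.intervalIntegrable _ _)
    (h2.intervalIntegrable _ _) fun t ht => ?_) a
  exact mul_le_mul_of_nonneg_left (radialMean_mono N hF hG h ht.1) ht.1

theorem le_radialSol (N : ℕ) (a : ℝ) {F : ℝ → ℝ} (h : ∀ r, 0 ≤ r → 0 ≤ F r) {r : ℝ} (hr : 0 ≤ r) :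
    a ≤ radialSol N a F r :=
  le_add_of_nonneg_right (intervalIntegral.integral_nonneg hr fun _ ht =>
    mul_nonneg ht.1 (radialMean_nonneg N h ht.1))

theorem abs_radialSol_sub_le (N : ℕ) (a : ℝ) {F : ℝ → ℝ} (hF : Continuous F) {R C : ℝ}
    (h : ∀ r, 0 ≤ r → r ≤ R → |F r| ≤ C) {r s : ℝ} (hr : r ∈ Icc 0 R) (hs : s ∈ Icc 0 R) :
    |radialSol N a F r - radialSol N a F s| ≤ R * C * |r - s| := by
  have h1 : Continuous fun t : ℝ => t * radialMean N F t :=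
    continuous_id.mul (continuous_radialMean N hF)
  have e : radialSol N a F r - radialSol N a F s = ∫ t in s..r, t * radialMean N F t := by
    rw [radialSol, radialSol, add_sub_add_left_eq_sub,
      intervalIntegral.integral_interval_sub_left (h1.intervalIntegrable _ _)
        (h1.intervalIntegrable _ _)]
  rw [e]
  rw [← Real.norm_eq_abs]
  refine intervalIntegral.norm_integral_le_of_norm_le_const fun t ht => ?_
  have ht' := uIcc_subset_Icc hs hr (uIoc_subset_uIcc ht)
  exact abs_mul_radialMean_le N h ht'.1 ht'.2

/-- A function whose derivative dominates `r F(r)` dominates the radial solution of `Δ u = F`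
in dimension at least three. -/
theorem radialSol_le {N : ℕ} (hN : 3 ≤ N) {F U U' : ℝ → ℝ} (hF : Continuous F)
    (hF0 : ∀ r, 0 ≤ r → 0 ≤ F r) (hU : ContinuousOn U (Ici 0))
    (hU' : ∀ r, 0 < r → HasDerivAt U (U' r) r) (h : ∀ r, 0 < r → r * F r ≤ U' r) {r : ℝ}
    (hr : 0 ≤ r) : radialSol N (U 0) F r ≤ U r := by
  have hN' : (1 : ℝ) ≤ N - 2 := by
    have : (3 : ℝ) ≤ N := by exact_mod_cast hN
    linarith
  -- Integration by parts gives Φ + r² w/(N-2) = U(0) + (1/(N-2)) ∫₀^r s F(s) ds, so subtracting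
  -- both terms from U leaves a derivative free of w.
  have hd : ∀ r, 0 < r → HasDerivAt
      (fun r => U r - radialSol N (U 0) F r - r ^ 2 * radialMean N F r / (N - 2))
      (U' r - r * F r / (N - 2)) r := by
    intro r hr
    have h1 := ((hU' r hr).sub (hasDerivAt_radialSol N (U 0) hF r)).sub
      (((hasDerivAt_pow 2 r).mul
        (hasDerivAt_radialMean (by omega : N ≠ 0) hF hr.ne')).div_const ((N : ℝ) - 2))
    refine h1.congr_deriv ?_
    have : (N : ℝ) - 2 ≠ 0 := by positivity
    field_simp
    push_cast
    ring
  have hm : MonotoneOn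
      (fun r => U r - radialSol N (U 0) F r - r ^ 2 * radialMean N F r / (N - 2)) (Ici 0) := by
    refine monotoneOn_of_deriv_nonneg (convex_Ici 0) ?_ ?_ ?_
    · have h1 := continuous_radialSol N (U 0) hF
      have h2 := continuous_radialMean N hF
      have h3 : Continuous fun r => r ^ 2 * radialMean N F r / ((N : ℝ) - 2) := by fun_prop
      exact (hU.sub h1.continuousOn).sub h3.continuousOn
    · rw [interior_Ici]
      exact fun x hx => (hd x hx).differentiableAt.differentiableWithinAt
    · rw [interior_Ici]
      intro x hx
      rw [(hd x hx).deriv, sub_nonneg]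
      refine le_trans (div_le_self ?_ hN') (h x hx)
      exact mul_nonneg (le_of_lt hx) (hF0 x (le_of_lt hx))
  have h0 := hm (mem_Ici.2 le_rfl) hr hr
  simp only [radialSol_zero] at h0
  have h1 : 0 ≤ r ^ 2 * radialMean N F r / ((N : ℝ) - 2) :=
    div_nonneg (mul_nonneg (sq_nonneg r) (radialMean_nonneg N hF0 hr)) (by linarith)
  simp at h0
  linarith

/-! ### Monotone iteration below a supersolution -/

theorem tendsto_radialSol (N : ℕ) (a : ℝ) {F : ℕ → ℝ → ℝ} {G : ℝ → ℝ}
    (hF : ∀ n, Continuous (F n)) (hlim : ∀ r, 0 ≤ r → Tendsto (fun n => F n r) atTop (𝓝 (G r)))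
    (hbdd : ∀ R, ∃ C, ∀ n r, 0 ≤ r → r ≤ R → |F n r| ≤ C) {r : ℝ} (hr : 0 ≤ r) :
    Tendsto (fun n => radialSol N a (F n) r) atTop (𝓝 (radialSol N a G r)) := by
  obtain ⟨C, hC⟩ := hbdd r
  refine Tendsto.const_add a ?_
  refine intervalIntegral.tendsto_integral_filter_of_dominated_convergence (fun _ => r * C)
    (Eventually.of_forall fun n => ?_) (Eventually.of_forall fun n => ?_)
    intervalIntegrable_const ?_
  · exact (continuous_id.mul (continuous_radialMean N (hF n))).aestronglyMeasurable
  · refine Eventually.of_forall fun t ht => ?_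
    rw [uIoc_of_le hr] at ht
    exact abs_mul_radialMean_le N (hC n) ht.1.le ht.2
  · refine Eventually.of_forall fun t ht => ?_
    rw [uIoc_of_le hr] at ht
    refine Tendsto.const_mul t ?_
    refine intervalIntegral.tendsto_integral_filter_of_dominated_convergence (fun _ => C)
      (Eventually.of_forall fun n => ?_) (Eventually.of_forall fun n => ?_)
      intervalIntegrable_const ?_
    · have := hF n
      exact Continuous.aestronglyMeasurable (by fun_prop)
    · exact Eventually.of_forall fun σ hσ => norm_mean_integrand_le N (hC n) ht.1.le ht.2 hσ
    · refine Eventually.of_forall fun σ hσ => ?_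
      rw [uIoc_of_le zero_le_one] at hσ
      exact (hlim _ (mul_nonneg hσ.1.le ht.1.le)).const_mul _

/-- Local bounds on F n make the profiles Lipschitz on [0, R] uniformly in n, and this passes to the
monotone limit. Using |r| extends the limit continuously to all of ℝ. -/
theorem exists_continuous_limit_radialSol (N : ℕ) (a : ℝ) {F : ℕ → ℝ → ℝ} {U : ℝ → ℝ}
    (hF : ∀ n, Continuous (F n)) (hbdd : ∀ R, ∃ C, ∀ n r, 0 ≤ r → r ≤ R → |F n r| ≤ C)
    (hmono : ∀ r, 0 ≤ r → Monotone fun n => radialSol N a (F n) r)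
    (hle : ∀ n r, 0 ≤ r → radialSol N a (F n) r ≤ U r) :
    ∃ u : ℝ → ℝ, Continuous u ∧
      ∀ r, Tendsto (fun n => radialSol N a (F n) |r|) atTop (𝓝 (u r)) := by
  refine ⟨fun r => ⨆ n, radialSol N a (F n) |r|, ?_, ?_⟩
  swap
  · exact fun r => tendsto_atTop_ciSup (hmono _ (abs_nonneg r))
      ⟨U |r|, by rintro _ ⟨n, rfl⟩; exact hle n _ (abs_nonneg r)⟩
  have ht : ∀ r, Tendsto (fun n => radialSol N a (F n) |r|) atTop
      (𝓝 (⨆ n, radialSol N a (F n) |r|)) := fun r =>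
    tendsto_atTop_ciSup (hmono _ (abs_nonneg r))
      ⟨U |r|, by rintro _ ⟨n, rfl⟩; exact hle n _ (abs_nonneg r)⟩
  refine continuous_iff_continuousAt.2 fun r => ?_
  obtain ⟨C, hC⟩ := hbdd (|r| + 1)
  rw [ContinuousAt, tendsto_iff_norm_sub_tendsto_zero]
  have hb : Tendsto (fun s => (|r| + 1) * C * |(|s| - |r|)|) (𝓝 r) (𝓝 0) := by
    have : Continuous fun s : ℝ => (|r| + 1) * C * |(|s| - |r|)| := by fun_prop
    simpa using this.tendsto r
  refine squeeze_zero' (Eventually.of_forall fun _ => norm_nonneg _) ?_ hb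
  have hn : ∀ᶠ s in 𝓝 r, |s| < |r| + 1 :=
    (continuous_abs.tendsto r).eventually_lt_const (by linarith)
  filter_upwards [hn] with s hs
  refine le_of_tendsto ((ht s).sub (ht r)).norm (Eventually.of_forall fun n => ?_)
  exact abs_radialSol_sub_le N a (hF n) (hC n) ⟨abs_nonneg s, hs.le⟩
    ⟨abs_nonneg r, by linarith⟩

/-- Monotone iterates for the radial system. -/
noncomputable def radialIter (N : ℕ) (a b α β : ℝ) (P Q : ℝ → ℝ) : ℕ → (ℝ → ℝ) × (ℝ → ℝ)
  | 0 => (fun _ => a, fun _ => b)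
  | n + 1 =>
    (radialSol N a fun s => P s * (radialIter N a b α β P Q n).2 s ^ α,
      radialSol N b fun s => Q s * (radialIter N a b α β P Q n).1 s ^ β)

/-- By induction the iterates lie between the constants U(0), V(0) and the supersolution, and they
increase because the nonlinearities do. Dominated convergence passes to the limit in the integral
equations. -/
theorem exists_radial_solution_of_supersolution {N : ℕ} (hN : 3 ≤ N) {α β : ℝ} (hα : 0 < α)
    (hβ : 0 < β) {P Q U V U' V' : ℝ → ℝ} (hP : Continuous P) (hQ : Continuous Q)
    (hP0 : ∀ r, 0 ≤ P r) (hQ0 : ∀ r, 0 ≤ Q r)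
    (hU : ContinuousOn U (Ici 0)) (hV : ContinuousOn V (Ici 0))
    (hUpos : ∀ r, 0 ≤ r → 0 < U r) (hVpos : ∀ r, 0 ≤ r → 0 < V r)
    (hU' : ∀ r, 0 < r → HasDerivAt U (U' r) r) (hV' : ∀ r, 0 < r → HasDerivAt V (V' r) r)
    (hPV : ∀ r, 0 < r → r * (P r * V r ^ α) ≤ U' r)
    (hQU : ∀ r, 0 < r → r * (Q r * U r ^ β) ≤ V' r) :
    ∃ u v : ℝ → ℝ, Continuous u ∧ Continuous v ∧ (∀ r, 0 < u r) ∧ (∀ r, 0 < v r) ∧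
      (∀ r, 0 ≤ r → u r = radialSol N (U 0) (fun s => P s * v s ^ α) r) ∧
      (∀ r, 0 ≤ r → v r = radialSol N (V 0) (fun s => Q s * u s ^ β) r) := by
  have hU0 := hUpos 0 le_rfl
  have hV0 := hVpos 0 le_rfl
  set S := radialIter N (U 0) (V 0) α β P Q with hS
  have S1 : ∀ n, (S (n + 1)).1 = radialSol N (U 0) fun s => P s * (S n).2 s ^ α := fun _ => rfl
  have S2 : ∀ n, (S (n + 1)).2 = radialSol N (V 0) fun s => Q s * (S n).1 s ^ β := fun _ => rfl
  have hpow : ∀ {γ : ℝ} {R f : ℝ → ℝ}, 0 < γ → Continuous R → Continuous f →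
      Continuous fun s => R s * f s ^ γ := fun hγ hR hf =>
    hR.mul (hf.rpow_const fun _ => Or.inr hγ.le)
  have hc : ∀ n, Continuous (S n).1 ∧ Continuous (S n).2 := by
    intro n
    induction n with
    | zero => exact ⟨continuous_const, continuous_const⟩
    | succ n ih =>
      exact ⟨continuous_radialSol _ _ (hpow hα hP ih.2), continuous_radialSol _ _ (hpow hβ hQ ih.1)⟩
  have hF := fun n => hpow hα hP (hc n).2
  have hG := fun n => hpow hβ hQ (hc n).1
  have hbounds : ∀ n r, 0 ≤ r →
      (U 0 ≤ (S n).1 r ∧ (S n).1 r ≤ U r) ∧ (V 0 ≤ (S n).2 r ∧ (S n).2 r ≤ V r) := by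
    have h0 : ∀ W W' : ℝ → ℝ, ContinuousOn W (Ici 0) → (∀ r, 0 < r → HasDerivAt W (W' r) r) →
        (∀ r, 0 < r → 0 ≤ W' r) → ∀ r, 0 ≤ r → W 0 ≤ W r := by
      intro W W' h1 h2 h3 r hr
      refine monotoneOn_of_deriv_nonneg (convex_Ici 0) h1 ?_ ?_ (mem_Ici.2 le_rfl) hr hr
      · rw [interior_Ici]
        exact fun x hx => (h2 x hx).differentiableAt.differentiableWithinAt
      · rw [interior_Ici]
        intro x hx
        rw [(h2 x hx).deriv]
        exact h3 x hx
    intro n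
    induction n with
    | zero =>
      intro r hr
      refine ⟨⟨le_rfl, h0 U U' hU hU' (fun r hr => ?_) r hr⟩,
        ⟨le_rfl, h0 V V' hV hV' (fun r hr => ?_) r hr⟩⟩
      · exact le_trans (mul_nonneg hr.le (mul_nonneg (hP0 r)
          (Real.rpow_nonneg (hVpos r hr.le).le _))) (hPV r hr)
      · exact le_trans (mul_nonneg hr.le (mul_nonneg (hQ0 r)
          (Real.rpow_nonneg (hUpos r hr.le).le _))) (hQU r hr)
    | succ n ih =>
      intro r hr
      have hF0 : ∀ r, 0 ≤ r → 0 ≤ P r * (S n).2 r ^ α := fun r hr =>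
        mul_nonneg (hP0 r) (Real.rpow_nonneg (hV0.le.trans (ih r hr).2.1) _)
      have hG0 : ∀ r, 0 ≤ r → 0 ≤ Q r * (S n).1 r ^ β := fun r hr =>
        mul_nonneg (hQ0 r) (Real.rpow_nonneg (hU0.le.trans (ih r hr).1.1) _)
      rw [S1, S2]
      refine ⟨⟨le_radialSol N _ hF0 hr, radialSol_le hN (hF n) hF0 hU hU' (fun r hr => ?_) hr⟩,
        ⟨le_radialSol N _ hG0 hr, radialSol_le hN (hG n) hG0 hV hV' (fun r hr => ?_) hr⟩⟩
      · refine le_trans ?_ (hPV r hr)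
        have h1 := ih r hr.le
        have := hP0 r
        have h2 : (S n).2 r ^ α ≤ V r ^ α :=
          Real.rpow_le_rpow (hV0.le.trans h1.2.1) h1.2.2 hα.le
        gcongr
      · refine le_trans ?_ (hQU r hr)
        have h1 := ih r hr.le
        have := hQ0 r
        have h2 : (S n).1 r ^ β ≤ U r ^ β :=
          Real.rpow_le_rpow (hU0.le.trans h1.1.1) h1.1.2 hβ.le
        gcongr
  have hFmono : ∀ n, (∀ r, 0 ≤ r → (S n).2 r ≤ (S (n + 1)).2 r) →
      ∀ r, 0 ≤ r → P r * (S n).2 r ^ α ≤ P r * (S (n + 1)).2 r ^ α := fun n h r hr =>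
    mul_le_mul_of_nonneg_left (Real.rpow_le_rpow (hV0.le.trans (hbounds n r hr).2.1) (h r hr)
      hα.le) (hP0 r)
  have hGmono : ∀ n, (∀ r, 0 ≤ r → (S n).1 r ≤ (S (n + 1)).1 r) →
      ∀ r, 0 ≤ r → Q r * (S n).1 r ^ β ≤ Q r * (S (n + 1)).1 r ^ β := fun n h r hr =>
    mul_le_mul_of_nonneg_left (Real.rpow_le_rpow (hU0.le.trans (hbounds n r hr).1.1) (h r hr)
      hβ.le) (hQ0 r)
  have hmono : ∀ n, (∀ r, 0 ≤ r → (S n).1 r ≤ (S (n + 1)).1 r) ∧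
      (∀ r, 0 ≤ r → (S n).2 r ≤ (S (n + 1)).2 r) := by
    intro n
    induction n with
    | zero => exact ⟨fun r hr => (hbounds 1 r hr).1.1, fun r hr => (hbounds 1 r hr).2.1⟩
    | succ n ih =>
      rw [S1 n, S1 (n + 1), S2 n, S2 (n + 1)]
      exact ⟨fun r hr => radialSol_mono N _ (hF n) (hF (n + 1)) (hFmono n ih.2) hr,
        fun r hr => radialSol_mono N _ (hG n) (hG (n + 1)) (hGmono n ih.1) hr⟩
  have hbdd : ∀ {γ : ℝ} {R f : ℝ → ℝ} {g : ℕ → ℝ → ℝ}, 0 < γ → Continuous R → (∀ r, 0 ≤ R r) →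
      ContinuousOn f (Ici 0) → (∀ n r, 0 ≤ r → 0 ≤ g n r ∧ g n r ≤ f r) →
      ∀ M, ∃ C, ∀ n r, 0 ≤ r → r ≤ M → |R r * g n r ^ γ| ≤ C := by
    intro γ R f g hγ hR hR0 hf hg M
    have hcont : ContinuousOn (fun r => R r * f r ^ γ) (Icc 0 M) :=
      hR.continuousOn.mul ((hf.mono Icc_subset_Ici_self).rpow_const fun _ _ => Or.inr hγ.le)
    obtain ⟨C, hC⟩ := isCompact_Icc.exists_bound_of_continuousOn hcont
    refine ⟨C, fun n r h0 hM => le_trans ?_ ((le_abs_self _).trans (hC r ⟨h0, hM⟩))⟩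
    rw [abs_of_nonneg (mul_nonneg (hR0 r) (Real.rpow_nonneg (hg n r h0).1 _))]
    exact mul_le_mul_of_nonneg_left (Real.rpow_le_rpow (hg n r h0).1 (hg n r h0).2 hγ.le) (hR0 r)
  have hFb := hbdd hα hP hP0 hV (g := fun n => (S n).2) fun n r hr =>
    ⟨hV0.le.trans (hbounds n r hr).2.1, (hbounds n r hr).2.2⟩
  have hGb := hbdd hβ hQ hQ0 hU (g := fun n => (S n).1) fun n r hr =>
    ⟨hU0.le.trans (hbounds n r hr).1.1, (hbounds n r hr).1.2⟩
  obtain ⟨u, huc, hu⟩ := exists_continuous_limit_radialSol N (U 0) hF hFb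
    (fun r hr => monotone_nat_of_le_succ fun n => by
      simpa only [← S1] using (hmono (n + 1)).1 r hr)
    (fun n r hr => by simpa only [← S1] using (hbounds (n + 1) r hr).1.2)
  obtain ⟨v, hvc, hv⟩ := exists_continuous_limit_radialSol N (V 0) hG hGb
    (fun r hr => monotone_nat_of_le_succ fun n => by
      simpa only [← S2] using (hmono (n + 1)).2 r hr)
    (fun n r hr => by simpa only [← S2] using (hbounds (n + 1) r hr).2.2)
  have hulim : ∀ r, 0 ≤ r → Tendsto (fun n => (S n).1 r) atTop (𝓝 (u r)) := fun r hr => by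
    rw [← tendsto_add_atTop_iff_nat 1]
    simpa only [S1, abs_of_nonneg hr] using hu r
  have hvlim : ∀ r, 0 ≤ r → Tendsto (fun n => (S n).2 r) atTop (𝓝 (v r)) := fun r hr => by
    rw [← tendsto_add_atTop_iff_nat 1]
    simpa only [S2, abs_of_nonneg hr] using hv r
  refine ⟨u, v, huc, hvc, fun r => hU0.trans_le ?_, fun r => hV0.trans_le ?_, fun r hr => ?_,
    fun r hr => ?_⟩
  · refine ge_of_tendsto (hu r) (Eventually.of_forall fun n => ?_)
    simpa only [← S1] using (hbounds (n + 1) |r| (abs_nonneg r)).1.1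
  · refine ge_of_tendsto (hv r) (Eventually.of_forall fun n => ?_)
    simpa only [← S2] using (hbounds (n + 1) |r| (abs_nonneg r)).2.1
  · have h1 := tendsto_radialSol N (U 0) hF (G := fun s => P s * v s ^ α)
      (fun s hs => ((hvlim s hs).rpow_const (Or.inr hα.le)).const_mul _) hFb hr
    have h2 := hu r
    rw [abs_of_nonneg hr] at h2
    exact tendsto_nhds_unique h2 h1
  · have h1 := tendsto_radialSol N (V 0) hG (G := fun s => Q s * u s ^ β)
      (fun s hs => ((hulim s hs).rpow_const (Or.inr hβ.le)).const_mul _) hGb hr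
    have h2 := hv r
    rw [abs_of_nonneg hr] at h2
    exact tendsto_nhds_unique h2 h1

/-! ### Absorbing constants by scaling -/

theorem exists_pos_small_rpow {C s t : ℝ} (hs : 0 < s) (ht : 0 < t) :
    ∃ ε : ℝ, 0 < ε ∧ C * ε ^ s ≤ 1 ∧ C * ε ^ t ≤ 1 := by
  have h : ∀ {s : ℝ}, 0 < s → ∀ᶠ ε in 𝓝[>] (0 : ℝ), C * ε ^ s ≤ 1 := by
    intro s hs
    have hc : ContinuousAt (fun ε : ℝ => C * ε ^ s) 0 :=
      continuousAt_const.mul (Real.continuousAt_rpow_const _ _ (Or.inr hs.le))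
    have ht : Tendsto (fun ε : ℝ => C * ε ^ s) (𝓝[>] 0) (𝓝 0) := by
      have := hc.tendsto
      simp only [Real.zero_rpow hs.ne', mul_zero] at this
      exact this.mono_left nhdsWithin_le_nhds
    exact (ht.eventually_lt_const one_pos).mono fun _ h => h.le
  obtain ⟨ε, ⟨h1, h2⟩, h3⟩ := ((h hs).and (h ht)).and self_mem_nhdsWithin |>.exists
  exact ⟨ε, h3, h1, h2⟩

/-- Replacing (U, V) by (εU, ε^t V) gains factors ε^(tα-1) and ε^(β-t). Both exponents are positive
when 1/α < t < β, a nonempty range since αβ > 1; a small ε then beats C. -/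
theorem exists_radial_solution_of_growth {N : ℕ} (hN : 3 ≤ N) {α β C : ℝ} (hα : 0 < α)
    (hβ : 0 < β) (hαβ : 1 < α * β) (hC : 0 < C) {P Q U V U' V' : ℝ → ℝ} (hP : Continuous P)
    (hQ : Continuous Q) (hP0 : ∀ r, 0 ≤ P r) (hQ0 : ∀ r, 0 ≤ Q r)
    (hU : ContinuousOn U (Ici 0)) (hV : ContinuousOn V (Ici 0))
    (hUpos : ∀ r, 0 ≤ r → 0 < U r) (hVpos : ∀ r, 0 ≤ r → 0 < V r)
    (hU' : ∀ r, 0 < r → HasDerivAt U (U' r) r) (hV' : ∀ r, 0 < r → HasDerivAt V (V' r) r)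
    (hPV : ∀ r, 0 < r → r * (P r * V r ^ α) ≤ C * U' r)
    (hQU : ∀ r, 0 < r → r * (Q r * U r ^ β) ≤ C * V' r) :
    ∃ (a b : ℝ) (u v : ℝ → ℝ), Continuous u ∧ Continuous v ∧ (∀ r, 0 < u r) ∧ (∀ r, 0 < v r) ∧
      (∀ r, 0 ≤ r → u r = radialSol N a (fun s => P s * v s ^ α) r) ∧
      (∀ r, 0 ≤ r → v r = radialSol N b (fun s => Q s * u s ^ β) r) := by
  obtain ⟨t, ht1, ht2⟩ := exists_between (show 1 / α < β by rw [div_lt_iff₀ hα]; linarith)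
  have ht1' : 0 < t * α - 1 := by rw [div_lt_iff₀ hα] at ht1; linarith
  obtain ⟨ε, hε, h1, h2⟩ := exists_pos_small_rpow (C := C) ht1' (sub_pos.2 ht2)
  have hδ : 0 < ε ^ t := Real.rpow_pos_of_pos hε t
  have e1 : (ε ^ t) ^ α = ε ^ (t * α - 1) * ε := by
    rw [← Real.rpow_mul hε.le, ← Real.rpow_add_one hε.ne']
    ring_nf
  have e2 : ε ^ β = ε ^ (β - t) * ε ^ t := by
    rw [← Real.rpow_add hε]
    ring_nf
  have hU'0 : ∀ r, 0 < r → 0 ≤ U' r := fun r hr =>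
    nonneg_of_mul_nonneg_right ((mul_nonneg hr.le (mul_nonneg (hP0 r)
      (Real.rpow_nonneg (hVpos r hr.le).le _))).trans (hPV r hr)) hC
  have hV'0 : ∀ r, 0 < r → 0 ≤ V' r := fun r hr =>
    nonneg_of_mul_nonneg_right ((mul_nonneg hr.le (mul_nonneg (hQ0 r)
      (Real.rpow_nonneg (hUpos r hr.le).le _))).trans (hQU r hr)) hC
  refine ⟨ε * U 0, ε ^ t * V 0, exists_radial_solution_of_supersolution hN hα hβ
    (U := fun r => ε * U r) (V := fun r => ε ^ t * V r) (U' := fun r => ε * U' r)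
    (V' := fun r => ε ^ t * V' r) hP hQ hP0 hQ0 (continuousOn_const.mul hU)
    (continuousOn_const.mul hV) (fun r hr => mul_pos hε (hUpos r hr))
    (fun r hr => mul_pos hδ (hVpos r hr)) (fun r hr => (hU' r hr).const_mul _)
    (fun r hr => (hV' r hr).const_mul _) (fun r hr => ?_) (fun r hr => ?_)⟩
  · rw [Real.mul_rpow hδ.le (hVpos r hr.le).le, e1]
    calc r * (P r * (ε ^ (t * α - 1) * ε * V r ^ α))
        = ε ^ (t * α - 1) * ε * (r * (P r * V r ^ α)) := by ring
      _ ≤ ε ^ (t * α - 1) * ε * (C * U' r) := by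
        have := hPV r hr
        gcongr
      _ = C * ε ^ (t * α - 1) * (ε * U' r) := by ring
      _ ≤ 1 * (ε * U' r) := mul_le_mul_of_nonneg_right h1 (mul_nonneg hε.le (hU'0 r hr))
      _ = ε * U' r := one_mul _
  · rw [Real.mul_rpow hε.le (hUpos r hr.le).le, e2]
    calc r * (Q r * (ε ^ (β - t) * ε ^ t * U r ^ β))
        = ε ^ (β - t) * ε ^ t * (r * (Q r * U r ^ β)) := by ring
      _ ≤ ε ^ (β - t) * ε ^ t * (C * V' r) := by
        have := hQU r hr
        gcongr
      _ = C * ε ^ (β - t) * (ε ^ t * V' r) := by ring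
      _ ≤ 1 * (ε ^ t * V' r) := mul_le_mul_of_nonneg_right h2 (mul_nonneg hδ.le (hV'0 r hr))
      _ = ε ^ t * V' r := one_mul _

/-! ### Logarithmic-power weights and their domination -/

theorem rpow_le_of_comparable {a b K : ℝ} (s : ℝ) (ha : 0 < a) (hab : a ≤ b) (hK : 1 ≤ K)
    (hb : b ≤ K * a) : a ^ s ≤ K ^ |s| * b ^ s := by
  have hK0 : 0 < K := by linarith
  have hb0 : 0 < b := by linarith
  rcases le_total 0 s with hs | hs
  · have h1 : a ^ s ≤ b ^ s := Real.rpow_le_rpow ha.le hab hs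
    have h2 : 1 ≤ K ^ |s| := Real.one_le_rpow hK (abs_nonneg s)
    nlinarith [Real.rpow_nonneg hb0.le s]
  · rw [abs_of_nonpos hs, Real.rpow_neg hK0.le, inv_mul_eq_div, le_div_iff₀ (by positivity),
      mul_comm, ← Real.mul_rpow hK0.le ha.le]
    exact Real.rpow_le_rpow_of_nonpos hb0 hb hs

/-- On [0, r₁] compactness suffices. Beyond r₁ > 1, r and M + r are comparable, and so are their
logarithms. The shift keeps the weight regular down to r = 0. -/
theorem exists_shifted_weight_bound {P : ℝ → ℝ} (hP : Continuous P) {lam ν L r₁ M : ℝ}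
    (hL : 0 < L) (hr₁ : 1 < r₁) (hM : Real.exp 1 ≤ M)
    (h : ∀ r, r₁ ≤ r → P r ≤ L / (r ^ lam * Real.log r ^ ν)) :
    ∃ C, 0 < C ∧ ∀ r, 0 ≤ r → P r ≤ C * ((M + r) ^ (-lam) * Real.log (M + r) ^ (-ν)) := by
  have hM1 : 1 < M := lt_of_lt_of_le (by simp) hM
  have hpos : ∀ r, 0 ≤ r → 0 < (M + r) ^ (-lam) * Real.log (M + r) ^ (-ν) := fun r hr =>
    mul_pos (Real.rpow_pos_of_pos (by linarith) _)
      (Real.rpow_pos_of_pos (Real.log_pos (by linarith)) _)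
  have hcont : ContinuousOn (fun r => P r / ((M + r) ^ (-lam) * Real.log (M + r) ^ (-ν)))
      (Icc 0 r₁) := by
    refine hP.continuousOn.div ?_ fun r hr => (hpos r hr.1).ne'
    refine ContinuousOn.mul ?_ ?_
    · refine ContinuousOn.rpow_const (by fun_prop) fun r hr => Or.inl ?_
      linarith [hr.1]
    · refine ContinuousOn.rpow_const (ContinuousOn.log (by fun_prop) fun r hr => ?_)
        fun r hr => Or.inl ?_
      · linarith [hr.1]
      · exact (Real.log_pos (by linarith [hr.1])).ne'
  obtain ⟨C, hC⟩ := isCompact_Icc.exists_bound_of_continuousOn hcont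
  have hl1 := Real.log_pos hr₁
  have hlM := Real.log_pos (show 1 < M + 1 by linarith)
  -- Chosen so that log(M + r) ≤ log(M + 1) + log r ≤ K log r for r ≥ r₁.
  set K := 1 + Real.log (M + 1) / Real.log r₁ with hK
  have hK1 : 1 ≤ K := by rw [hK]; linarith [div_pos hlM hl1]
  set D := L * ((M + 1) ^ |(-lam)| * K ^ |(-ν)|) with hD
  have hD0 : 0 < D := by positivity
  refine ⟨max C D, lt_max_of_lt_right hD0, fun r hr => ?_⟩
  rcases le_total r r₁ with hrr | hrr
  · have h1 := (le_abs_self _).trans (hC r ⟨hr, hrr⟩)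
    rw [div_le_iff₀ (hpos r hr)] at h1
    exact h1.trans (mul_le_mul_of_nonneg_right (le_max_left _ _) (hpos r hr).le)
  · have hr1 : 1 < r := hr₁.trans_le hrr
    have hlr := Real.log_pos hr1
    have h1 : r ^ (-lam) ≤ (M + 1) ^ |(-lam)| * (M + r) ^ (-lam) :=
      rpow_le_of_comparable _ (by linarith) (by linarith) (by linarith) (by nlinarith)
    have h2 : Real.log r ^ (-ν) ≤ K ^ |(-ν)| * Real.log (M + r) ^ (-ν) := by
      refine rpow_le_of_comparable _ hlr (Real.log_le_log (by linarith) (by linarith)) hK1 ?_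
      have h3 : Real.log (M + r) ≤ Real.log (M + 1) + Real.log r := by
        rw [← Real.log_mul (by linarith) (by linarith)]
        exact Real.log_le_log (by linarith) (by nlinarith)
      have h4 : Real.log (M + 1) ≤ Real.log (M + 1) / Real.log r₁ * Real.log r := by
        rw [div_mul_eq_mul_div, le_div_iff₀ hl1]
        exact mul_le_mul_of_nonneg_left (Real.log_le_log (by linarith) hrr) hlM.le
      rw [hK]
      linarith
    calc P r ≤ L / (r ^ lam * Real.log r ^ ν) := h r hrr
      _ = L * (r ^ (-lam) * Real.log r ^ (-ν)) := by
        rw [Real.rpow_neg (by linarith), Real.rpow_neg hlr.le, div_eq_mul_inv, mul_inv]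
      _ ≤ L * (((M + 1) ^ |(-lam)| * (M + r) ^ (-lam)) *
          (K ^ |(-ν)| * Real.log (M + r) ^ (-ν))) := by
        have : 0 ≤ Real.log r ^ (-ν) := Real.rpow_nonneg hlr.le _
        have : 0 ≤ (M + r) ^ (-lam) := Real.rpow_nonneg (by linarith) _
        gcongr
      _ = D * ((M + r) ^ (-lam) * Real.log (M + r) ^ (-ν)) := by rw [hD]; ring
      _ ≤ _ := mul_le_mul_of_nonneg_right (le_max_right _ _) (hpos r hr).le

/-- On `[M, ∞)`, the function `x ^ A * log x ^ c` is dominated by a multiple of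
`x` times the derivative of `x ^ k * log x ^ m`. -/
def LogPowerDominated (M A c k m : ℝ) : Prop :=
  ∃ C, 0 < C ∧ ∀ x, M ≤ x →
    x ^ A * Real.log x ^ c ≤ C * (x ^ k * (Real.log x ^ (m - 1) * (k * Real.log x + m)))

theorem one_le_log_of_exp_le {M x : ℝ} (hM : Real.exp 1 ≤ M) (hx : M ≤ x) : 1 ≤ Real.log x := by
  rw [Real.le_log_iff_exp_le (by linarith [Real.exp_pos 1])]
  linarith

/-- A strict gap between the powers of x absorbs any power of log x. -/
theorem logPowerDominated_of_lt {M A k : ℝ} (c : ℝ) (hM : Real.exp 1 ≤ M) (hk : 0 < k)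
    (hA : A < k) : LogPowerDominated M A c k 0 := by
  -- Makes δ|c| ≤ k - A; the added 1 covers c = 0.
  have hδ : 0 < (k - A) / (|c| + 1) := div_pos (by linarith) (by positivity)
  set δ := (k - A) / (|c| + 1) with hδd
  refine ⟨(δ⁻¹) ^ |c| / k, by positivity, fun x hx => ?_⟩
  have hl := one_le_log_of_exp_le hM hx
  have hx1 : 1 < x := lt_of_lt_of_le (by simp) (hM.trans hx)
  have hx0 : 0 < x := by linarith
  have h1 : Real.log x ^ c ≤ (δ⁻¹) ^ |c| * x ^ (k - A) := by
    calc Real.log x ^ c ≤ Real.log x ^ |c| := Real.rpow_le_rpow_of_exponent_le hl (le_abs_self c)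
      _ ≤ (x ^ δ / δ) ^ |c| :=
        Real.rpow_le_rpow (by linarith) (Real.log_le_rpow_div hx0.le hδ) (abs_nonneg c)
      _ = (δ⁻¹) ^ |c| * x ^ (δ * |c|) := by
        rw [div_eq_inv_mul, Real.mul_rpow (by positivity) (by positivity), ← Real.rpow_mul hx0.le]
      _ ≤ (δ⁻¹) ^ |c| * x ^ (k - A) := by
        have : δ * |c| ≤ k - A := by
          have : δ * (|c| + 1) = k - A := div_mul_cancel₀ _ (by positivity)
          nlinarith
        have := Real.rpow_le_rpow_of_exponent_le hx1.le this
        gcongr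
  have h2 : Real.log x ^ ((0 : ℝ) - 1) * (k * Real.log x + 0) = k := by
    rw [zero_sub, Real.rpow_neg_one]
    field_simp
    ring
  rw [h2]
  calc x ^ A * Real.log x ^ c ≤ x ^ A * ((δ⁻¹) ^ |c| * x ^ (k - A)) := by gcongr
    _ = (δ⁻¹) ^ |c| * x ^ (A + (k - A)) := by rw [Real.rpow_add hx0]; ring
    _ = (δ⁻¹) ^ |c| / k * (x ^ k * k) := by
      rw [add_sub_cancel]
      field_simp

/-- Once log x ≥ 2|m|/k, the factor k log x + m is at least (k/2) log x. -/
theorem logPowerDominated_self {M k m : ℝ} (hM : Real.exp 1 ≤ M) (hk : 0 < k)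
    (hMk : Real.exp (2 * |m| / k) ≤ M) : LogPowerDominated M k m k m := by
  refine ⟨2 / k, by positivity, fun x hx => ?_⟩
  have hl := one_le_log_of_exp_le hM hx
  have hx0 : 0 < x := lt_of_lt_of_le (Real.exp_pos 1) (hM.trans hx)
  have h1 : 2 * |m| / k ≤ Real.log x := by
    rw [Real.le_log_iff_exp_le hx0]
    exact hMk.trans hx
  rw [div_le_iff₀ hk] at h1
  have h2 : Real.log x ≤ 2 / k * (k * Real.log x + m) := by
    rw [div_mul_eq_mul_div, le_div_iff₀ hk]
    nlinarith [neg_abs_le m]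
  calc x ^ k * Real.log x ^ m = x ^ k * (Real.log x ^ (m - 1) * Real.log x) := by
        rw [← Real.rpow_add_one (by linarith), sub_add_cancel]
    _ ≤ x ^ k * (Real.log x ^ (m - 1) * (2 / k * (k * Real.log x + m))) := by
        have : 0 ≤ Real.log x ^ (m - 1) := Real.rpow_nonneg (by linarith) _
        gcongr
    _ = _ := by ring

/-- For k = 0, x times the derivative of (log x)^m is m (log x)^(m-1): exactly one logarithm is
lost. -/
theorem logPowerDominated_log {M c m : ℝ} (hM : Real.exp 1 ≤ M) (hm : 0 < m) (hc : c ≤ m - 1) :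
    LogPowerDominated M 0 c 0 m := by
  refine ⟨1 / m, by positivity, fun x hx => ?_⟩
  have hl := one_le_log_of_exp_le hM hx
  have h1 := Real.rpow_le_rpow_of_exponent_le hl hc
  have h2 : 1 / m * (x ^ (0 : ℝ) * (Real.log x ^ (m - 1) * (0 * Real.log x + m))) =
      Real.log x ^ (m - 1) := by
    rw [Real.rpow_zero]
    field_simp
    ring
  rw [h2, Real.rpow_zero, one_mul]
  exact h1

theorem hasDerivAt_logPower {M k m r : ℝ} (hM : Real.exp 1 ≤ M) (hr : 0 ≤ r) :
    HasDerivAt (fun r => (M + r) ^ k * Real.log (M + r) ^ m)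
      ((M + r) ^ (k - 1) * (Real.log (M + r) ^ (m - 1) * (k * Real.log (M + r) + m))) r := by
  have hl := one_le_log_of_exp_le hM (show M ≤ M + r by linarith)
  have hx0 : 0 < M + r := by linarith [Real.exp_pos 1]
  have h0 : HasDerivAt (fun r => M + r) 1 r := (hasDerivAt_id r).const_add M
  have h1 := (h0.rpow_const (p := k) (Or.inl hx0.ne')).mul
    ((h0.log hx0.ne').rpow_const (p := m) (Or.inl (by linarith)))
  refine h1.congr_deriv ?_
  have e1 : (M + r) ^ k = (M + r) ^ (k - 1) * (M + r) := by
    rw [← Real.rpow_add_one hx0.ne', sub_add_cancel]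
  have e2 : Real.log (M + r) ^ m = Real.log (M + r) ^ (m - 1) * Real.log (M + r) := by
    rw [← Real.rpow_add_one (by linarith), sub_add_cancel]
  rw [e1, e2]
  field_simp

/-- The 2 in the exponent counts the factor r ≤ x and the factor x that turns a derivative into x
times a derivative, with x = M + r. -/
theorem exists_mul_weight_le {P : ℝ → ℝ} (hP : Continuous P)
    {lam ν L r₁ M γ l n k m : ℝ} (hL : 0 < L) (hr₁ : 1 < r₁) (hM : Real.exp 1 ≤ M)
    (h : ∀ r, r₁ ≤ r → P r ≤ L / (r ^ lam * Real.log r ^ ν))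
    (hdom : LogPowerDominated M (2 - lam + γ * l) (γ * n - ν) k m) :
    ∃ C, 0 < C ∧ ∀ r, 0 < r → r * (P r * ((M + r) ^ l * Real.log (M + r) ^ n) ^ γ) ≤
      C * ((M + r) ^ (k - 1) * (Real.log (M + r) ^ (m - 1) * (k * Real.log (M + r) + m))) := by
  obtain ⟨C₁, hC₁, h1⟩ := exists_shifted_weight_bound hP hL hr₁ hM h
  obtain ⟨C₂, hC₂, h2⟩ := hdom
  refine ⟨C₁ * C₂, by positivity, fun r hr => ?_⟩
  have hM0 : 0 < M := (Real.exp_pos 1).trans_le hM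
  have hl := one_le_log_of_exp_le hM (show M ≤ M + r by linarith)
  have h1 := h1 r hr.le
  have h2 := h2 (M + r) (by linarith)
  have hrx : r ≤ M + r := by linarith
  have hx0 : 0 < M + r := by linarith
  set x := M + r with hx
  set y := Real.log x with hy
  have hy0 : 0 < y := by linarith
  have e1 : (x ^ l * y ^ n) ^ γ = x ^ (γ * l) * y ^ (γ * n) := by
    rw [Real.mul_rpow (by positivity) (by positivity), ← Real.rpow_mul hx0.le,
      ← Real.rpow_mul hy0.le, mul_comm l, mul_comm n]
  have e2 : x ^ (2 - lam + γ * l) = x * x * (x ^ (-lam) * x ^ (γ * l)) := by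
    rw [← sq, ← Real.rpow_two, ← Real.rpow_add hx0, ← Real.rpow_add hx0]
    ring_nf
  have e3 : y ^ (γ * n - ν) = y ^ (-ν) * y ^ (γ * n) := by
    rw [← Real.rpow_add hy0]
    ring_nf
  have e4 : x ^ k = x * x ^ (k - 1) := by
    rw [mul_comm, ← Real.rpow_add_one hx0.ne', sub_add_cancel]
  rw [e2, e3, e4] at h2
  have h3 : x * (x ^ (-lam) * x ^ (γ * l)) * (y ^ (-ν) * y ^ (γ * n)) ≤
      C₂ * (x ^ (k - 1) * (y ^ (m - 1) * (k * y + m))) := by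
    refine le_of_mul_le_mul_left ?_ hx0
    calc _ = x * x * (x ^ (-lam) * x ^ (γ * l)) * (y ^ (-ν) * y ^ (γ * n)) := by ring
      _ ≤ _ := h2
      _ = _ := by ring
  rw [e1]
  calc r * (P r * (x ^ (γ * l) * y ^ (γ * n)))
      ≤ x * ((C₁ * (x ^ (-lam) * y ^ (-ν))) * (x ^ (γ * l) * y ^ (γ * n))) := by
        have : 0 ≤ x ^ (γ * l) * y ^ (γ * n) := by positivity
        have h5 := mul_le_mul_of_nonneg_right h1 this
        have h6 : 0 ≤ (C₁ * (x ^ (-lam) * y ^ (-ν))) * (x ^ (γ * l) * y ^ (γ * n)) := by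
          positivity
        nlinarith [mul_le_mul_of_nonneg_left h5 hr.le, mul_le_mul_of_nonneg_right hrx h6]
    _ = C₁ * (x * (x ^ (-lam) * x ^ (γ * l)) * (y ^ (-ν) * y ^ (γ * n))) := by ring
    _ ≤ C₁ * (C₂ * (x ^ (k - 1) * (y ^ (m - 1) * (k * y + m)))) :=
        mul_le_mul_of_nonneg_left h3 hC₁.le
    _ = _ := by ring

theorem exists_radial_solution_of_logPowerDominated {N : ℕ} (hN : 3 ≤ N) {α β : ℝ} (hα : 0 < α)
    (hβ : 0 < β) (hαβ : 1 < α * β) {P Q : ℝ → ℝ} (hP : Continuous P) (hQ : Continuous Q)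
    (hP0 : ∀ r, 0 ≤ P r) (hQ0 : ∀ r, 0 ≤ Q r) {lam ν μ ξ L₃ L₄ r₁ M k m l n : ℝ}
    (hL₃ : 0 < L₃) (hL₄ : 0 < L₄) (hr₁ : 1 < r₁) (hM : Real.exp 1 ≤ M)
    (hPb : ∀ r, r₁ ≤ r → P r ≤ L₃ / (r ^ lam * Real.log r ^ ν))
    (hQb : ∀ r, r₁ ≤ r → Q r ≤ L₄ / (r ^ μ * Real.log r ^ ξ))
    (h₁ : LogPowerDominated M (2 - lam + α * l) (α * n - ν) k m)
    (h₂ : LogPowerDominated M (2 - μ + β * k) (β * m - ξ) l n) :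
    ∃ (a b : ℝ) (u v : ℝ → ℝ), Continuous u ∧ Continuous v ∧ (∀ r, 0 < u r) ∧ (∀ r, 0 < v r) ∧
      (∀ r, 0 ≤ r → u r = radialSol N a (fun s => P s * v s ^ α) r) ∧
      (∀ r, 0 ≤ r → v r = radialSol N b (fun s => Q s * u s ^ β) r) := by
  obtain ⟨C₁, hC₁, h₁⟩ := exists_mul_weight_le hP hL₃ hr₁ hM hPb h₁
  obtain ⟨C₂, hC₂, h₂⟩ := exists_mul_weight_le hQ hL₄ hr₁ hM hQb h₂
  have hpos : ∀ k m r : ℝ, 0 ≤ r → 0 < (M + r) ^ k * Real.log (M + r) ^ m := fun k m r hr =>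
    mul_pos (Real.rpow_pos_of_pos (by linarith [Real.exp_pos 1]) _) (Real.rpow_pos_of_pos
      (by linarith [one_le_log_of_exp_le hM (show M ≤ M + r by linarith)]) _)
  have hcont : ∀ k m : ℝ, ContinuousOn (fun r => (M + r) ^ k * Real.log (M + r) ^ m) (Ici 0) :=
    fun k m r hr => (hasDerivAt_logPower hM hr).continuousAt.continuousWithinAt
  have hmax : ∀ {c D X Y : ℝ}, 0 < c → c ≤ D → 0 ≤ X → X ≤ c * Y → X ≤ D * Y :=
    fun hc hcD hX hXY => hXY.trans (mul_le_mul_of_nonneg_right hcD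
      (nonneg_of_mul_nonneg_right (hX.trans hXY) hc))
  refine exists_radial_solution_of_growth hN hα hβ hαβ (lt_max_of_lt_left hC₁ : 0 < max C₁ C₂)
    hP hQ hP0 hQ0 (hcont k m) (hcont l n) (hpos k m) (hpos l n)
    (fun r hr => hasDerivAt_logPower hM hr.le) (fun r hr => hasDerivAt_logPower hM hr.le)
    (fun r hr => hmax hC₁ (le_max_left _ _) ?_ (h₁ r hr))
    (fun r hr => hmax hC₂ (le_max_right _ _) ?_ (h₂ r hr))
  · exact mul_nonneg hr.le (mul_nonneg (hP0 r) (Real.rpow_nonneg (hpos _ _ r hr.le).le _))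
  · exact mul_nonneg hr.le (mul_nonneg (hQ0 r) (Real.rpow_nonneg (hpos _ _ r hr.le).le _))

/-! ### Choice of exponents in the four cases -/

/-- A suitable k exists as soon as max(0, A + αl) < (l - B)/β, that is, l > B and l(αβ - 1) < -(B +
βA). The two hypotheses say that this leaves room for l above 0 and above B, respectively. -/
theorem exists_growth_exponents {α β A B : ℝ} (hβ : 0 < β) (hαβ : 1 < α * β)
    (h₁ : B + β * A < 0) (h₂ : A + α * B < 0) :
    ∃ k l : ℝ, 0 < k ∧ 0 < l ∧ A + α * l < k ∧ B + β * k < l := by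
  have hd : 0 < α * β - 1 := by linarith
  obtain ⟨l, hl₁, hl₂⟩ := exists_between
    (show max 0 B < -(B + β * A) / (α * β - 1) by
      rw [max_lt_iff, lt_div_iff₀ hd, lt_div_iff₀ hd]
      constructor <;> nlinarith)
  rw [max_lt_iff] at hl₁
  rw [lt_div_iff₀ hd] at hl₂
  obtain ⟨k, hk₁, hk₂⟩ := exists_between
    (show max 0 (A + α * l) < (l - B) / β by
      rw [max_lt_iff, lt_div_iff₀ hβ, lt_div_iff₀ hβ]
      constructor <;> nlinarith)
  rw [max_lt_iff] at hk₁
  rw [lt_div_iff₀ hβ] at hk₂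
  exact ⟨k, l, hk₁.1, hl₁.1, hk₁.2, by linarith⟩

/-- The borderline case `2 - μ + β (2 - lam) = 0`. -/
theorem exists_dominating_exponents_of_borderline {α β lam ν μ ξ : ℝ} (hαβ : 1 < α * β)
    (h₁ : 2 - μ + β * (2 - lam) = 0) (h₂ : lam < 2) (h₃ : 1 - ξ - β * ν < 0) :
    ∃ M k m l n : ℝ, Real.exp 1 ≤ M ∧
      LogPowerDominated M (2 - lam + α * l) (α * n - ν) k m ∧
      LogPowerDominated M (2 - μ + β * k) (β * m - ξ) l n := by
  -- Solves βm - ξ = n - 1 with m = αn - ν, the equality case of both dominations.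
  set n := (ξ + β * ν - 1) / (α * β - 1) with hn
  have hn0 : 0 < n := div_pos (by linarith) (by linarith)
  have hn1 : n * (α * β - 1) = ξ + β * ν - 1 := div_mul_cancel₀ _ (by linarith)
  set M := max (Real.exp 1) (Real.exp (2 * |α * n - ν| / (2 - lam)))
  refine ⟨M, 2 - lam, α * n - ν, 0, n, le_max_left _ _, ?_, ?_⟩
  · rw [mul_zero, add_zero]
    exact logPowerDominated_self (le_max_left _ _) (by linarith) (le_max_right _ _)
  · rw [h₁]
    exact logPowerDominated_log (le_max_left _ _) hn0 (by nlinarith)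

theorem exists_dominating_exponents {α β lam ν μ ξ : ℝ} (hβ : 0 < β) (hαβ : 1 < α * β)
    (hcond :
      (2 - μ + β * (2 - lam) < 0 ∧ 2 - lam + α * (2 - μ) < 0) ∨
      (2 - μ + β * (2 - lam) = 0 ∧ lam < 2 ∧ 1 - ξ - β * ν < 0) ∨
      (2 - lam + α * (2 - μ) = 0 ∧ μ < 2 ∧ 1 - ν - α * ξ < 0) ∨
      (lam = 2 ∧ μ = 2 ∧ 1 - ξ + β * (1 - ν) < 0 ∧ 1 - ν + α * (1 - ξ) < 0)) :
    ∃ M k m l n : ℝ, Real.exp 1 ≤ M ∧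
      LogPowerDominated M (2 - lam + α * l) (α * n - ν) k m ∧
      LogPowerDominated M (2 - μ + β * k) (β * m - ξ) l n := by
  rcases hcond with ⟨h₁, h₂⟩ | ⟨h₁, h₂, h₃⟩ | ⟨h₁, h₂, h₃⟩ | ⟨rfl, rfl, h₁, h₂⟩
  · obtain ⟨k, l, hk, hl, h₃, h₄⟩ := exists_growth_exponents hβ hαβ h₁ h₂
    exact ⟨Real.exp 1, k, 0, l, 0, le_rfl, logPowerDominated_of_lt _ le_rfl hk h₃,
      logPowerDominated_of_lt _ le_rfl hl h₄⟩
  · exact exists_dominating_exponents_of_borderline hαβ h₁ h₂ h₃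
  · obtain ⟨M, l, n, k, m, hM, h₄, h₅⟩ := exists_dominating_exponents_of_borderline
      (α := β) (β := α) (by linarith) h₁ h₂ h₃
    exact ⟨M, k, m, l, n, hM, h₅, h₄⟩
  -- With no powers of x left, the exponents of the logarithms obey the inequalities of case (i),
  -- with 1 - ν and 1 - ξ in place of 2 - λ and 2 - μ.
  · obtain ⟨m, n, hm, hn, h₃, h₄⟩ := exists_growth_exponents hβ hαβ h₁ h₂
    refine ⟨Real.exp 1, 0, m, 0, n, le_rfl, ?_, ?_⟩
    · rw [sub_self, mul_zero, add_zero]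
      exact logPowerDominated_log le_rfl hm (by linarith)
    · rw [sub_self, mul_zero, add_zero]
      exact logPowerDominated_log le_rfl hn (by linarith)

/-! ### Return to the whole space -/

theorem theorem3 (N : ℕ) (hN : 3 ≤ N) (α β : ℝ) (hα : 0 < α) (hβ : 0 < β) (hαβ : 1 < α * β)
    (p q : EuclideanSpace ℝ (Fin N) → ℝ)
    (hp_cont : Continuous p) (hq_cont : Continuous q)
    (hp_nonneg : ∀ x, 0 ≤ p x) (hq_nonneg : ∀ x, 0 ≤ q x)
    (hp_radial : IsRadial p) (hq_radial : IsRadial q)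
    (lam ν μ ξ L₃ L₄ r₁ : ℝ) (hL₃ : 0 < L₃) (hL₄ : 0 < L₄) (hr₁ : 1 < r₁)
    (hp_bound : ∀ x, r₁ ≤ ‖x‖ → p x ≤ L₃ / (‖x‖ ^ lam * Real.log ‖x‖ ^ ν))
    (hq_bound : ∀ x, r₁ ≤ ‖x‖ → q x ≤ L₄ / (‖x‖ ^ μ * Real.log ‖x‖ ^ ξ))
    (hcond :
      (2 - μ + β * (2 - lam) < 0 ∧ 2 - lam + α * (2 - μ) < 0) ∨
      (2 - μ + β * (2 - lam) = 0 ∧ lam < 2 ∧ 1 - ξ - β * ν < 0) ∨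
      (2 - lam + α * (2 - μ) = 0 ∧ μ < 2 ∧ 1 - ν - α * ξ < 0) ∨
      (lam = 2 ∧ μ = 2 ∧ 1 - ξ + β * (1 - ν) < 0 ∧ 1 - ν + α * (1 - ξ) < 0)) :
    ∃ u v : EuclideanSpace ℝ (Fin N) → ℝ, IsPositiveEntireSolution α β p q u v := by
  obtain ⟨M, k, m, l, n, hM, h₁, h₂⟩ := exists_dominating_exponents hβ hαβ hcond
  -- A unit vector: restricting p and q to the line ℝe gives continuous profiles on all of ℝ.
  set e : EuclideanSpace ℝ (Fin N) := EuclideanSpace.single ⟨0, by omega⟩ 1 with he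
  have hne : ∀ r : ℝ, 0 ≤ r → ‖r • e‖ = r := fun r hr => by
    simp [norm_smul, he, abs_of_nonneg hr]
  have hpe : ∀ x, p (‖x‖ • e) = p x := fun x => hp_radial _ _ (hne _ (norm_nonneg x))
  have hqe : ∀ x, q (‖x‖ • e) = q x := fun x => hq_radial _ _ (hne _ (norm_nonneg x))
  have hPc : Continuous fun r : ℝ => p (r • e) := by fun_prop
  have hQc : Continuous fun r : ℝ => q (r • e) := by fun_prop
  obtain ⟨a, b, u, v, hu, hv, hu0, hv0, hue, hve⟩ :=
    exists_radial_solution_of_logPowerDominated hN hα hβ hαβ hPc hQc (fun _ => hp_nonneg _)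
      (fun _ => hq_nonneg _) hL₃ hL₄ hr₁ hM
      (fun r hr => by
        have h := hp_bound (r • e)
        rw [hne r (by linarith)] at h
        exact h hr)
      (fun r hr => by
        have h := hq_bound (r • e)
        rw [hne r (by linarith)] at h
        exact h hr) h₁ h₂
  have hFc : Continuous fun s : ℝ => p (s • e) * v s ^ α :=
    hPc.mul (hv.rpow_const fun _ => Or.inr hα.le)
  have hGc : Continuous fun s : ℝ => q (s • e) * u s ^ β :=
    hQc.mul (hu.rpow_const fun _ => Or.inr hβ.le)
  have hN0 : N ≠ 0 := by omega
  have hfin : Module.finrank ℝ (EuclideanSpace ℝ (Fin N)) = N := finrank_euclideanSpace_fin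
  have hux : (fun x : EuclideanSpace ℝ (Fin N) => u ‖x‖) = fun x =>
      radialSol N a (fun s => p (s • e) * v s ^ α) ‖x‖ := funext fun x => hue _ (norm_nonneg x)
  have hvx : (fun x : EuclideanSpace ℝ (Fin N) => v ‖x‖) = fun x =>
      radialSol N b (fun s => q (s • e) * u s ^ β) ‖x‖ := funext fun x => hve _ (norm_nonneg x)
  refine ⟨fun x => u ‖x‖, fun x => v ‖x‖, ?_, ?_, fun x => hu0 _, fun x => hv0 _, fun x => ?_,
    fun x => ?_⟩
  · rw [hux]
    exact contDiff_radialSol_norm hN0 a hFc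
  · rw [hvx]
    exact contDiff_radialSol_norm hN0 b hGc
  · rw [hux]
    have h := laplacian_radialSol_norm (by rw [hfin]; exact hN0) a hFc x
    rw [hfin] at h
    rw [h, hpe]
  · rw [hvx]
    have h := laplacian_radialSol_norm (by rw [hfin]; exact hN0) b hGc x
    rw [hfin] at h
    rw [h, hqe]
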